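/- Let $k$ be a field, let $n\ge 3$, and let $R=k[x_1,\dots,x_n]$ be the standard graded polynomial ring. Let $J\subset R$ be an ideal of height $2$ generated by three forms of the same degree $d$, and suppose that $J$ is not perfect, i.e. the projective dimension of $R/J$ is not equal to the grade of $J$ (the maximal length of an $R$-regular sequence contained in $J$). Then every minimal graded free resolution of $J$ has the form $$\cdots\to F_2\to\bigoplus_{i=1}^{m}R(-d-\delta_i)\to R(-d)^3\to J\to 0$$ with $m\ge 3$ and non-negative integers $\delta_1\le\delta_2\le\cdots\le\delta_m$, where the $F_i$ are graded free modules of finite rank, and $$\delta_3\le d .$$ -/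

import Mathlib

universe u

/-- The grade of an ideal `I` of a (Noetherian) ring `R`: the supremum of the lengths of the
`R`-regular sequences whose members lie in `I`. -/
noncomputable def idealGrade {R : Type u} [CommRing R] (I : Ideal R) : ℕ∞ :=
  ⨆ rs : {rs : List R // (∀ r ∈ rs, r ∈ I) ∧ RingTheory.Sequence.IsRegular R rs},
    (rs.1.length : ℕ∞)

/-- A proper ideal `I` of a (Noetherian) ring `R` is perfect if the projective dimension of the
`R`-module `R ⧸ I` equals the grade of `I`. -/
def IsPerfectIdeal {R : Type u} [CommRing R] (I : Ideal R) : Prop :=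
  I ≠ ⊤ ∧
    CategoryTheory.projectiveDimension (ModuleCat.of R (R ⧸ I)) = ((idealGrade I : ℕ∞) : WithBot ℕ∞)

/-- `p` is a form of degree `e`, where `e` is an integer; the zero polynomial is a form of every
degree, and it is the only form of a negative degree. -/
def IsFormOfDegree {k : Type u} [Field k] {n : ℕ} (p : MvPolynomial (Fin n) k) (e : ℤ) : Prop :=
  ∀ m : Fin n →₀ ℕ, p.coeff m ≠ 0 → (m.degree : ℤ) = e

/-- A minimal graded free resolution
`⋯ → F₂ → F₁ → F₀ → J → 0` of an ideal `J` of the standard graded ring `R = k[x₁, …, xₙ]`,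
where `Fᵢ = ⨁ⱼ R(-shift i j)` has finite rank `rank i`, and the maps are given by matrices with
respect to the standard bases. (By the syzygy theorem `rank i = 0` for large `i`; this is a
consequence and is not required.) -/
structure MinimalGradedFreeResolution {k : Type u} [Field k] {n : ℕ}
    (J : Ideal (MvPolynomial (Fin n) k)) where
  /-- the rank of the free module `Fᵢ` -/
  rank : ℕ → ℕ
  /-- the degrees of the basis elements of `Fᵢ` -/
  shift : (i : ℕ) → Fin (rank i) → ℤ
  /-- the images in `J` of the basis elements of `F₀` -/
  gen : Fin (rank 0) → MvPolynomial (Fin n) k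
  /-- the matrix of the map `Fᵢ₊₁ → Fᵢ`; its columns are the images of the basis elements -/
  diff : (i : ℕ) → Matrix (Fin (rank i)) (Fin (rank (i + 1))) (MvPolynomial (Fin n) k)
  /-- `F₀ → J` preserves degrees -/
  gen_form : ∀ j, IsFormOfDegree (gen j) (shift 0 j)
  /-- `Fᵢ₊₁ → Fᵢ` preserves degrees -/
  diff_form : ∀ i l j, IsFormOfDegree (diff i l j) (shift (i + 1) j - shift i l)
  /-- `F₀ → J` is surjective -/
  span_gen : Ideal.span (Set.range gen) = J
  /-- exactness at `F₀` -/
  exact_zero : Function.Exact (diff 0).mulVecLin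
    (Fintype.linearCombination (MvPolynomial (Fin n) k) gen)
  /-- exactness at `Fᵢ₊₁` -/
  exact_succ : ∀ i, Function.Exact (diff (i + 1)).mulVecLin (diff i).mulVecLin
  /-- minimality: the entries of all the matrices lie in the ideal `(x₁, …, xₙ)` -/
  minimal : ∀ i l j, diff i l j ∈
    Ideal.span (Set.range (MvPolynomial.X : Fin n → MvPolynomial (Fin n) k))

/-! Minimality leaves at most three generators, all of degree d; fewer than three would make J
perfect. Let f be the vector of generators and suppose at most two minimal relations have degree ≤
2d. The Koszul relations e_i × f have degree 2d, so they are combinations of two relations s, t.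
Both are orthogonal to f, whose entries have no common factor because J has height 2; hence s × t =
h f. The cross product of two Koszul relations is a multiple of s × t, but also equals ± f_l f or 0,
so h divides every f_l and is a unit (`isPerfectIdeal_of_koszul`). Then J is generated by the 2 × 2
minors of (s, t), the sequence 0 → R² → R³ → J → 0 is exact, and J is perfect: a contradiction. -/

open RingTheory.Sequence

/-! ### Grade, height and projective dimension -/

section CommAlg

variable {R : Type u} [CommRing R]

/-- A prime ideal containing a weakly regular sequence of length `r` has height at least `r`. -/
theorem length_le_height_of_isWeaklyRegular (rs : List R) (hrs : IsWeaklyRegular R rs)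
    (p : Ideal R) [p.IsPrime] (hp : ∀ r ∈ rs, r ∈ p) : (rs.length : ℕ∞) ≤ p.height := by
  induction rs using List.reverseRecOn generalizing p with
  | nil => simp
  | append_singleton rs r ih =>
    rw [isWeaklyRegular_append_iff, isWeaklyRegular_singleton_iff] at hrs
    obtain ⟨h1, h2⟩ := hrs
    have hle : Ideal.ofList rs ≤ p := by
      rw [Ideal.ofList, Ideal.span_le]
      intro x hx
      exact hp x (by simp only [List.mem_append]; exact Or.inl hx)
    -- As a nonzerodivisor modulo `rs`, `r` avoids every minimal prime over `rs`, so `q` lies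
    -- strictly below `p`.
    obtain ⟨q, hq, hqp⟩ := Ideal.exists_minimalPrimes_le hle
    have := hq.isPrime
    have hrq : r ∉ q := by
      apply IsSMulRegular.notMem_of_mem_minimalPrimes h2
      simpa [Ideal.annihilator_quotient] using hq
    have hlt : q < p := lt_of_le_of_ne hqp fun h => hrq (h ▸ hp r (by simp))
    have hih := ih h1 q fun x hx => hq.1.2 (Ideal.subset_span hx)
    calc ((rs ++ [r]).length : ℕ∞) = rs.length + 1 := by simp
      _ ≤ q.height + 1 := by gcongr
      _ ≤ p.height := Ideal.height_add_one_le_of_lt_of_isPrime hlt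

theorem idealGrade_le_height (J : Ideal R) : idealGrade J ≤ J.height := by
  refine iSup_le fun ⟨rs, hmem, hreg⟩ => ?_
  rw [Ideal.height_eq_inf_minimalPrimes]
  refine le_iInf₂ fun p hp => ?_
  have := hp.isPrime
  exact length_le_height_of_isWeaklyRegular rs hreg.toIsWeaklyRegular p fun r hr =>
    hp.1.2 (hmem r hr)

theorem hasProjectiveDimensionLT_quotient_iff (J : Ideal R) (n : ℕ) :
    CategoryTheory.HasProjectiveDimensionLT (ModuleCat.of R (R ⧸ J)) (n + 2) ↔
      CategoryTheory.HasProjectiveDimensionLT (ModuleCat.of R J) (n + 1) := by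
  have h := (LinearMap.shortExact_shortComplexKer J.mkQ_surjective
    ).hasProjectiveDimensionLT_X₃_iff n (ModuleCat.projective_of_categoryTheory_projective (ModuleCat.of R R))
  have e : (ModuleCat.of R (LinearMap.ker J.mkQ)) ≅ ModuleCat.of R J :=
    (LinearEquiv.ofEq _ _ J.ker_mkQ).toModuleIso
  refine h.trans ⟨fun _ => CategoryTheory.hasProjectiveDimensionLT_of_iso e _, fun _ =>
    CategoryTheory.hasProjectiveDimensionLT_of_iso e.symm _⟩

/-! ### Ideals of height two in factorial domains -/

variable [IsDomain R] [IsNoetherianRing R] [UniqueFactorizationMonoid R]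

omit [IsDomain R] [UniqueFactorizationMonoid R] in
theorem not_le_span_singleton_of_prime {J : Ideal R} (hJ : 1 < J.height) {p : R} (hp : Prime p) :
    ¬ J ≤ Ideal.span {p} := fun h =>
  absurd (hJ.trans_le (Ideal.height_mono h)) (Ideal.height_span_singleton_le_one hp.not_isUnit).not_gt

omit [IsNoetherianRing R] [UniqueFactorizationMonoid R] in
theorem ne_bot_of_one_lt_height {J : Ideal R} (hJ : 1 < J.height) : J ≠ ⊥ := by
  rintro rfl
  simp at hJ

/-- The elements of an ideal of height at least two have no common factor. -/
theorem dvd_of_forall_dvd_mul {J : Ideal R} (hJ : 1 < J.height) (a : R) :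
    ∀ b : R, (∀ x ∈ J, a ∣ b * x) → a ∣ b := by
  induction a using UniqueFactorizationMonoid.induction_on_prime with
  | h₁ =>
    intro b hb
    obtain ⟨x, hx, hx0⟩ := Submodule.exists_mem_ne_zero_of_ne_bot (ne_bot_of_one_lt_height hJ)
    have := zero_dvd_iff.1 (hb x hx)
    simpa [hx0] using this
  | h₂ a ha => intro b _; exact ha.dvd
  | h₃ a p ha hp ih =>
    intro b hb
    -- Some `x ∈ J` is not divisible by `p`, so `p` divides `b` and can be cancelled.
    obtain ⟨x, hx, hxp⟩ := Set.not_subset.1 (not_le_span_singleton_of_prime hJ hp)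
    have hxp' : ¬ p ∣ x := fun h => hxp (Ideal.mem_span_singleton.2 h)
    obtain ⟨c, rfl⟩ := (hp.dvd_or_dvd ((dvd_mul_right p a).trans (hb x hx))).resolve_right hxp'
    refine mul_dvd_mul_left p (ih c fun y hy => ?_)
    have := hb y hy
    rw [mul_assoc] at this
    exact (mul_dvd_mul_iff_left hp.ne_zero).1 this

/-- For a nonzero `a`, an ideal of height at least two contains an element coprime to `a`. -/
theorem exists_mem_forall_dvd {J : Ideal R} (hJ : 1 < J.height) {a : R} (ha : a ≠ 0) :
    ∃ b ∈ J, ∀ c, a ∣ b * c → a ∣ c := by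
  classical
  let s := (UniqueFactorizationMonoid.factors a).toFinset
  have hs : ∀ q ∈ s, Prime q := fun q hq =>
    UniqueFactorizationMonoid.prime_of_factor q (by simpa [s] using hq)
  -- Prime avoidance over the prime factors of `a`.
  have hnot : ¬ ((J : Set R) ⊆ ⋃ q ∈ (s : Set R), (Ideal.span {q} : Ideal R)) := by
    rw [Ideal.subset_union_prime 0 0 fun q hq _ _ =>
      (Ideal.span_singleton_prime (hs q hq).ne_zero).2 (hs q hq)]
    rintro ⟨q, hq, hle⟩
    exact not_le_span_singleton_of_prime hJ (hs q hq) hle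
  obtain ⟨b, hb, hbs⟩ := Set.not_subset.1 hnot
  refine ⟨b, hb, fun c hc => ?_⟩
  refine UniqueFactorizationMonoid.dvd_of_dvd_mul_right_of_no_prime_factors ha
    (fun {d} hda hdb hd => hbs ?_) hc
  obtain ⟨q, hq, hdq⟩ := UniqueFactorizationMonoid.exists_mem_factors_of_dvd ha hd.irreducible hda
  exact Set.mem_biUnion (by simpa [s] using hq)
    (Ideal.mem_span_singleton.2 (hdq.dvd_iff_dvd_left.1 hdb))

theorem two_le_idealGrade {J : Ideal R} (hJ : 1 < J.height) (hJt : J ≠ ⊤) : 2 ≤ idealGrade J := by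
  obtain ⟨a, ha, ha0⟩ := Submodule.exists_mem_ne_zero_of_ne_bot (ne_bot_of_one_lt_height hJ)
  obtain ⟨b, hb, hab⟩ := exists_mem_forall_dvd hJ ha0
  have hmem : ∀ r ∈ [a, b], r ∈ J := by simp [ha, hb]
  have hreg : IsRegular R [a, b] := by
    refine ⟨?_, ?_⟩
    · rw [show [a, b] = [a] ++ [b] from rfl, isWeaklyRegular_append_iff,
        isWeaklyRegular_singleton_iff, isWeaklyRegular_singleton_iff]
      refine ⟨fun x y h => mul_left_cancel₀ ha0 h, ?_⟩
      rw [isSMulRegular_iff_right_eq_zero_of_smul]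
      intro x hx
      obtain ⟨x, rfl⟩ := Submodule.Quotient.mk_surjective _ x
      rw [← Submodule.Quotient.mk_smul, Submodule.Quotient.mk_eq_zero] at hx
      rw [Submodule.Quotient.mk_eq_zero]
      simp only [Ideal.ofList_singleton, smul_eq_mul, Ideal.mul_top,
        Ideal.mem_span_singleton] at hx ⊢
      exact hab x hx
    · intro h
      apply hJt
      rw [eq_top_iff, h, smul_eq_mul, Ideal.mul_top, Ideal.ofList, Ideal.span_le]
      exact hmem
  exact le_iSup (fun rs : {rs : List R // (∀ r ∈ rs, r ∈ J) ∧ IsRegular R rs} =>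
    (rs.1.length : ℕ∞)) ⟨[a, b], hmem, hreg⟩

/-- A proper ideal of height at least two is not projective. -/
theorem not_projective_of_one_lt_height {J : Ideal R} (hJ : 1 < J.height) (hJt : J ≠ ⊤) :
    ¬ Module.Projective R J := by
  intro hproj
  obtain ⟨s, hs⟩ := Module.projective_def'.1 hproj
  obtain ⟨a, ha, ha0⟩ := Submodule.exists_mem_ne_zero_of_ne_bot (ne_bot_of_one_lt_height hJ)
  -- This symmetry forces `a ∣ φ a` for every functional φ. Dividing the dual basis expansion of `a`
  -- by `a` then puts 1 in `J`.
  have hlin : ∀ (φ : J →ₗ[R] R) (x y : J), (x : R) * φ y = y * φ x := by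
    intro φ x y
    rw [← smul_eq_mul, ← smul_eq_mul, ← map_smul, ← map_smul]
    congr 1
    ext
    simp [mul_comm]
  have hmul : ∀ φ : J →ₗ[R] R, a ∣ φ ⟨a, ha⟩ := fun φ =>
    dvd_of_forall_dvd_mul hJ a _ fun x hx => ⟨φ ⟨x, hx⟩, by
      rw [mul_comm]; exact hlin φ ⟨x, hx⟩ ⟨a, ha⟩⟩
  have key := congrArg (fun z : J => (z : R)) (LinearMap.congr_fun hs ⟨a, ha⟩)
  simp only [LinearMap.comp_apply, LinearMap.id_apply, Finsupp.linearCombination_apply,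
    Finsupp.sum, AddSubmonoidClass.coe_finsetSum, Submodule.coe_smul, smul_eq_mul, id_eq] at key
  choose c hc using fun j : J => hmul ((Finsupp.lapply j).comp s)
  simp only [LinearMap.comp_apply, Finsupp.lapply_apply] at hc
  have : a * ∑ j ∈ (s ⟨a, ha⟩).support, c j * (j : R) = a * 1 := by
    rw [Finset.mul_sum, mul_one]
    refine Eq.trans (Finset.sum_congr rfl fun j _ => ?_) key
    rw [hc j, mul_assoc]
  have h1 := mul_left_cancel₀ ha0 this
  exact hJt ((Ideal.eq_top_iff_one J).2 (h1 ▸ J.sum_mem fun j _ => J.mul_mem_left _ j.2))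

omit [IsNoetherianRing R] [UniqueFactorizationMonoid R] in
theorem exists_ne_zero_of_span_range {J : Ideal R} (hJ : 1 < J.height) {ι : Type*} (f : ι → R)
    (hf : Ideal.span (Set.range f) = J) : ∃ i, f i ≠ 0 := by
  by_contra! hall
  refine ne_bot_of_one_lt_height hJ ?_
  rw [← hf, Ideal.span_eq_bot]
  rintro _ ⟨i, rfl⟩
  exact hall i

/-! ### Cross products and Hilbert–Burch -/

open Matrix in
/-- A vector parallel to a vector whose entries have no common factor is a multiple of it. -/
theorem exists_eq_smul_of_cross_eq_zero {J : Ideal R} (hJ : 1 < J.height)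
    (f w : Fin 3 → R) (hf : Ideal.span (Set.range f) = J) (h : f ⨯₃ w = 0) :
    ∃ c : R, w = c • f := by
  have hpar : ∀ i j, f i * w j = f j * w i := by
    have h0 := congrFun h 0
    have h1 := congrFun h 1
    have h2 := congrFun h 2
    simp only [cross_apply, cons_val, Pi.zero_apply] at h0 h1 h2
    intro i j
    fin_cases i <;> fin_cases j <;> simp <;> grind
  obtain ⟨i, hi⟩ := exists_ne_zero_of_span_range hJ f hf
  obtain ⟨c, hc⟩ : f i ∣ w i := by
    refine dvd_of_forall_dvd_mul hJ _ _ fun x hx => ?_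
    rw [← hf] at hx
    induction hx using Submodule.span_induction with
    | mem x hx => obtain ⟨j, rfl⟩ := hx; exact ⟨w j, by rw [hpar, mul_comm]⟩
    | zero => simp
    | add x y _ _ hx hy => rw [mul_add]; exact dvd_add hx hy
    | smul a x _ hx => rw [smul_eq_mul, mul_left_comm]; exact hx.mul_left a
  refine ⟨c, funext fun j => mul_left_cancel₀ hi ?_⟩
  rw [hpar, hc, Pi.smul_apply, smul_eq_mul]
  ring

open Matrix in
/-- If the entries of `s × t` have no common factor, then the vectors orthogonal to `s × t` are the
linear combinations of `s` and `t`. -/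
theorem exists_eq_smul_add_smul_of_dotProduct_cross_eq_zero {J : Ideal R} (hJ : 1 < J.height)
    (s t : Fin 3 → R) (hst : Ideal.span (Set.range (s ⨯₃ t)) = J) (v : Fin 3 → R)
    (hv : v ⬝ᵥ (s ⨯₃ t) = 0) : ∃ a b : R, v = a • s + b • t := by
  obtain ⟨a, ha⟩ := exists_eq_smul_of_cross_eq_zero hJ (s ⨯₃ t) (v ⨯₃ s) hst (by
    rw [cross_cross_eq_smul_sub_smul', hv, dotProduct_comm _ s, dot_self_cross]
    simp)
  obtain ⟨b, hb⟩ := exists_eq_smul_of_cross_eq_zero hJ (s ⨯₃ t) (v ⨯₃ t) hst (by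
    rw [cross_cross_eq_smul_sub_smul', hv, dotProduct_comm _ t, dot_cross_self]
    simp)
  obtain ⟨j, hj⟩ := exists_ne_zero_of_span_range hJ _ hst
  -- If v = x s + y t, then v × t = x (s × t) and v × s = -y (s × t), which dictates the
  -- coefficients.
  refine ⟨b, -a, funext fun i => ?_⟩
  rw [← sub_eq_zero]
  refine (mul_eq_zero.1 ?_).resolve_right hj
  have a0 := congrFun ha 0
  have a1 := congrFun ha 1
  have a2 := congrFun ha 2
  have b0 := congrFun hb 0
  have b1 := congrFun hb 1
  have b2 := congrFun hb 2
  simp only [cross_apply, cons_val, Pi.smul_apply, smul_eq_mul] at a0 a1 a2 b0 b1 b2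
  fin_cases i <;> fin_cases j <;>
    simp only [cross_apply, cons_val, Pi.add_apply, Pi.smul_apply, smul_eq_mul, Fin.zero_eta, Fin.mk_one,
      Fin.reduceFinMk] <;> grind

-- The relations of s × t form a free module on s and t, so J has a free resolution of length one.
open Matrix in
theorem hasProjectiveDimensionLT_two_of_span_cross {J : Ideal R} (hJ : 1 < J.height)
    (s t : Fin 3 → R) (hst : Ideal.span (Set.range (s ⨯₃ t)) = J) :
    CategoryTheory.HasProjectiveDimensionLT (ModuleCat.of R J) 2 := by
  let φ := Fintype.linearCombination R (s ⨯₃ t)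
  have hφ : ∀ v, φ v = v ⬝ᵥ (s ⨯₃ t) := fun v => by
    simp [φ, Fintype.linearCombination_apply, dotProduct]
  have hrange : LinearMap.range φ = J := by
    rw [← hst]
    exact Fintype.range_linearCombination R (s ⨯₃ t)
  let ι : R × R →ₗ[R] (Fin 3 → R) :=
    (LinearMap.toSpanSingleton R _ s).coprod (LinearMap.toSpanSingleton R _ t)
  have hι : ∀ p, ι p = p.1 • s + p.2 • t := fun p => by simp [ι]
  have hmem : ∀ p, ι p ∈ LinearMap.ker φ.rangeRestrict := fun p => by
    rw [LinearMap.ker_rangeRestrict, LinearMap.mem_ker, hφ, hι, add_dotProduct, smul_dotProduct,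
      smul_dotProduct, dot_self_cross, dot_cross_self]
    simp
  obtain ⟨j, hj⟩ := exists_ne_zero_of_span_range hJ _ hst
  have hbij : Function.Bijective (ι.codRestrict _ hmem) := by
    constructor
    · rw [injective_iff_map_eq_zero]
      intro p hp
      have hp' : p.1 • s + p.2 • t = 0 := by
        rw [← hι]; exact congrArg Subtype.val hp
      have h1 : p.1 • (s ⨯₃ t) = 0 := by
        simpa using congrArg (fun v => v ⨯₃ t) hp'
      have h2 : p.2 • (s ⨯₃ t) = 0 := by
        simpa using congrArg (fun v => s ⨯₃ v) hp'
      have h1j := congrFun h1 j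
      have h2j := congrFun h2 j
      simp only [Pi.smul_apply, smul_eq_mul, Pi.zero_apply, mul_eq_zero, hj, or_false] at h1j h2j
      exact Prod.ext h1j h2j
    · rintro ⟨v, hv⟩
      rw [LinearMap.ker_rangeRestrict, LinearMap.mem_ker, hφ] at hv
      obtain ⟨a, b, rfl⟩ := exists_eq_smul_add_smul_of_dotProduct_cross_eq_zero hJ s t hst v hv
      exact ⟨(a, b), Subtype.ext (hι _)⟩
  have hker : Module.Projective R (LinearMap.ker φ.rangeRestrict) :=
    Module.Projective.of_equiv (LinearEquiv.ofBijective _ hbij)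
  have hpr := ModuleCat.projective_of_categoryTheory_projective
    (ModuleCat.of R (LinearMap.ker φ.rangeRestrict))
  have h := ((LinearMap.shortExact_shortComplexKer φ.surjective_rangeRestrict
    ).hasProjectiveDimensionLT_X₃_iff 0 (ModuleCat.projective_of_categoryTheory_projective
      (ModuleCat.of R (Fin 3 → R)))).2 (CategoryTheory.projective_iff_hasProjectiveDimensionLT_one.1 hpr)
  have e : ModuleCat.of R (LinearMap.range φ) ≅ ModuleCat.of R J :=
    (LinearEquiv.ofEq _ _ hrange).toModuleIso
  have h' : CategoryTheory.HasProjectiveDimensionLT (ModuleCat.of R (LinearMap.range φ)) 2 := h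
  exact CategoryTheory.hasProjectiveDimensionLT_of_iso e _

open Matrix in
/-- The Hilbert–Burch ideals of height two in a factorial Noetherian domain are perfect. -/
theorem isPerfectIdeal_of_span_cross {J : Ideal R} (hJ : J.height = 2)
    (s t : Fin 3 → R) (hst : Ideal.span (Set.range (s ⨯₃ t)) = J) : IsPerfectIdeal J := by
  have hJ1 : 1 < J.height := by rw [hJ]; norm_num
  have hJt : J ≠ ⊤ := by
    rintro rfl
    simp at hJ
  refine ⟨hJt, ?_⟩
  have hgrade : idealGrade J = 2 :=
    le_antisymm (hJ ▸ idealGrade_le_height J) (two_le_idealGrade hJ1 hJt)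
  rw [hgrade]
  refine le_antisymm ?_ ?_
  · exact (CategoryTheory.projectiveDimension_le_iff _ 2).2
      ((hasProjectiveDimensionLT_quotient_iff J 1).2
        (hasProjectiveDimensionLT_two_of_span_cross hJ1 s t hst))
  -- A smaller projective dimension would make `J` itself projective.
  · refine (CategoryTheory.projectiveDimension_ge_iff _ 2).2 fun h => ?_
    have hp := CategoryTheory.projective_iff_hasProjectiveDimensionLT_one.2
      ((hasProjectiveDimensionLT_quotient_iff J 0).1 h)
    exact not_projective_of_one_lt_height hJ1 hJt
      ((IsProjective.iff_projective (ModuleCat.of R J)).2 hp)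

/-- An ideal of height two generated by two elements is perfect. -/
theorem isPerfectIdeal_of_span_pair {J : Ideal R} (hJ : J.height = 2) (a b : R)
    (hab : Ideal.span {a, b} = J) : IsPerfectIdeal J := by
  -- The cross product of these two vectors is (a, b, 0).
  refine isPerfectIdeal_of_span_cross hJ ![-b, a, 0] ![0, 0, 1] ?_
  rw [← hab, cross_apply]
  refine le_antisymm (Ideal.span_le.2 ?_) (Ideal.span_le.2 ?_)
  · rintro _ ⟨i, rfl⟩
    fin_cases i
    · exact Ideal.subset_span (by simp)
    · exact Ideal.subset_span (by simp)
    · simp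
  · rintro x (rfl | rfl)
    · exact Ideal.subset_span ⟨0, by simp⟩
    · exact Ideal.subset_span ⟨1, by simp⟩

/-- An ideal of height two generated by at most two elements is perfect. -/
theorem isPerfectIdeal_of_span_range {J : Ideal R} (hJ : J.height = 2) {r : ℕ} (hr : r ≤ 2)
    (g : Fin r → R) (hg : Ideal.span (Set.range g) = J) : IsPerfectIdeal J := by
  match r, hr with
  | 0, _ => exact isPerfectIdeal_of_span_pair hJ 0 0 (by rw [← hg]; simp)
  | 1, _ => exact isPerfectIdeal_of_span_pair hJ (g 0) (g 0) (by
    rw [← hg, Set.range_unique]; simp)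
  | 2, _ =>
    refine isPerfectIdeal_of_span_pair hJ (g 0) (g 1) (hg ▸ congrArg _ ?_)
    ext x
    simp [Fin.exists_fin_two, eq_comm]

open Matrix in
/-- An ideal of height two with three generators is perfect if the Koszul relations between the
generators are linear combinations of two relations. -/
theorem isPerfectIdeal_of_koszul {J : Ideal R} (hJ : J.height = 2) (f s t : Fin 3 → R)
    (hf : Ideal.span (Set.range f) = J) (hs : s ⬝ᵥ f = 0) (ht : t ⬝ᵥ f = 0)
    (hK : ∀ i : Fin 3, ∃ a b : R, Pi.single i 1 ⨯₃ f = a • s + b • t) : IsPerfectIdeal J := by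
  have hJ1 : 1 < J.height := by rw [hJ]; norm_num
  obtain ⟨h, hh⟩ := exists_eq_smul_of_cross_eq_zero hJ1 f (s ⨯₃ t) hf (by
    rw [cross_cross_eq_smul_sub_smul', dotProduct_comm f t, ht, hs]
    simp)
  obtain ⟨i₀, hi₀⟩ := exists_ne_zero_of_span_range hJ1 f hf
  have hcross : ∀ i j, h ∣ (f ⬝ᵥ (Pi.single i 1 ⨯₃ Pi.single j 1)) := by
    intro i j
    obtain ⟨a, b, hab⟩ := hK i
    obtain ⟨a', b', hab'⟩ := hK j
    have h1 : (Pi.single i 1 ⨯₃ f) ⨯₃ (Pi.single j 1 ⨯₃ f) =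
        (f ⬝ᵥ (Pi.single i 1 ⨯₃ Pi.single j 1)) • f := by
      ext l
      fin_cases l <;> simp [cross_apply, dotProduct, Fin.sum_univ_three] <;> ring
    have h2 : (Pi.single i 1 ⨯₃ f) ⨯₃ (Pi.single j 1 ⨯₃ f) = (a * b' - b * a') • (s ⨯₃ t) := by
      rw [hab, hab']
      ext l
      fin_cases l <;> simp [cross_apply] <;> ring
    refine ⟨a * b' - b * a', mul_right_cancel₀ hi₀ ?_⟩
    have := congrFun (h1.symm.trans h2) i₀
    rw [hh] at this
    simp only [Pi.smul_apply, smul_eq_mul] at this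
    rw [this]
    ring
  have hdvd : ∀ i, h ∣ f i := by
    intro i
    have h0 := hcross 1 2
    have h1 := hcross 2 0
    have h2 := hcross 0 1
    simp [cross_apply, dotProduct, Fin.sum_univ_three] at h0 h1 h2
    fin_cases i
    exacts [h0, h1, h2]
  have hunit : IsUnit h := by
    refine isUnit_iff_dvd_one.2 (dvd_of_forall_dvd_mul hJ1 h 1 fun x hx => ?_)
    rw [one_mul, ← Ideal.mem_span_singleton]
    rw [← hf] at hx
    refine Ideal.span_le.2 ?_ hx
    rintro _ ⟨i, rfl⟩
    exact Ideal.mem_span_singleton.2 (hdvd i)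
  obtain ⟨u, rfl⟩ := hunit
  refine isPerfectIdeal_of_span_cross hJ s t ?_
  rw [← hf, hh]
  refine le_antisymm (Ideal.span_le.2 ?_) (Ideal.span_le.2 ?_)
  · rintro _ ⟨i, rfl⟩
    exact Ideal.mul_mem_left _ _ (Ideal.subset_span ⟨i, rfl⟩)
  · rintro _ ⟨i, rfl⟩
    have : f i = ↑u⁻¹ * ((u : R) • f) i := by simp
    rw [this]
    exact Ideal.mul_mem_left _ _ (Ideal.subset_span ⟨i, rfl⟩)

end CommAlg

/-! ### Homogeneous components in integral degrees -/

section Graded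

open MvPolynomial

variable {k : Type u} [Field k] {n : ℕ}

/-- The homogeneous component of integral degree `e` of a polynomial. -/
noncomputable def degreePart (e : ℤ) (p : MvPolynomial (Fin n) k) : MvPolynomial (Fin n) k :=
  if 0 ≤ e then homogeneousComponent e.toNat p else 0

theorem coeff_degreePart (e : ℤ) (p : MvPolynomial (Fin n) k) (m : Fin n →₀ ℕ) :
    (degreePart e p).coeff m = if (m.degree : ℤ) = e then p.coeff m else 0 := by
  unfold degreePart
  split_ifs with h1 h2 h2
  · rw [coeff_homogeneousComponent, if_pos (by omega)]
  · rw [coeff_homogeneousComponent, if_neg (by omega)]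
  · omega
  · simp

theorem degreePart_of_neg {e : ℤ} (he : e < 0) (p : MvPolynomial (Fin n) k) :
    degreePart e p = 0 := if_neg he.not_ge

theorem degreePart_sum {ι : Type*} (s : Finset ι) (e : ℤ) (p : ι → MvPolynomial (Fin n) k) :
    degreePart e (∑ i ∈ s, p i) = ∑ i ∈ s, degreePart e (p i) := by
  unfold degreePart
  split_ifs <;> simp

theorem IsFormOfDegree.degreePart_eq {e : ℤ} {p : MvPolynomial (Fin n) k}
    (hp : IsFormOfDegree p e) : degreePart e p = p := by
  ext m
  rw [coeff_degreePart]
  split_ifs with h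
  · rfl
  · by_contra hne
    exact h (hp m (Ne.symm hne))

theorem IsFormOfDegree.degreePart_mul {a : ℤ} {q : MvPolynomial (Fin n) k}
    (hq : IsFormOfDegree q a) (e : ℤ) (p : MvPolynomial (Fin n) k) :
    degreePart e (p * q) = degreePart (e - a) p * q := by
  classical
  ext m
  have h : ∀ x ∈ Finset.HasAntidiagonal.antidiagonal m, (degreePart (e - a) p).coeff x.1 * q.coeff x.2 =
      if (m.degree : ℤ) = e then p.coeff x.1 * q.coeff x.2 else 0 := fun x hx => by
    rw [coeff_degreePart, ← Finset.HasAntidiagonal.mem_antidiagonal.1 hx, map_add]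
    by_cases h0 : q.coeff x.2 = 0
    · simp [h0]
    · have := hq _ h0
      push_cast
      split_ifs <;> first | rfl | omega | simp
  rw [coeff_degreePart, coeff_mul, coeff_mul, Finset.sum_congr rfl h]
  split_ifs <;> simp

theorem IsFormOfDegree.nonneg {e : ℤ} {p : MvPolynomial (Fin n) k} (hp : IsFormOfDegree p e)
    (h0 : p ≠ 0) : 0 ≤ e := by
  obtain ⟨m, hm⟩ := ne_zero_iff.1 h0
  have := hp m hm
  omega

theorem MvPolynomial.IsHomogeneous.isFormOfDegree {d : ℕ} {p : MvPolynomial (Fin n) k}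
    (hp : p.IsHomogeneous d) : IsFormOfDegree p d := fun m hm => by
  have := hp hm
  rw [Pi.one_def, ← Finsupp.degree_eq_weight_one] at this
  exact_mod_cast this

theorem constantCoeff_eq_zero_of_mem_span_X {p : MvPolynomial (Fin n) k}
    (hp : p ∈ Ideal.span (Set.range (X : Fin n → MvPolynomial (Fin n) k))) :
    constantCoeff p = 0 := by
  refine (Ideal.span_le (I := RingHom.ker (constantCoeff (σ := Fin n) (R := k)))).2 ?_ hp
  rintro _ ⟨i, rfl⟩
  simp [RingHom.mem_ker]

/-! ### Consequences of minimality -/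

namespace MinimalGradedFreeResolution

variable {J : Ideal (MvPolynomial (Fin n) k)} (F : MinimalGradedFreeResolution J)

open Matrix

theorem constantCoeff_mulVec_diff (i : ℕ) (w : Fin (F.rank (i + 1)) → MvPolynomial (Fin n) k)
    (l : Fin (F.rank i)) : constantCoeff ((F.diff i *ᵥ w) l) = 0 := by
  simp only [mulVec, dotProduct, map_sum, map_mul,
    constantCoeff_eq_zero_of_mem_span_X (F.minimal _ _ _), zero_mul, Finset.sum_const_zero]

theorem exists_mulVec_eq_of_sum_gen {v : Fin (F.rank 0) → MvPolynomial (Fin n) k}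
    (hv : ∑ l, v l * F.gen l = 0) : ∃ w, F.diff 0 *ᵥ w = v := by
  have := (F.exact_zero v).1 (by simpa [Fintype.linearCombination_apply] using hv)
  simpa using this

theorem constantCoeff_of_sum_gen {v : Fin (F.rank 0) → MvPolynomial (Fin n) k}
    (hv : ∑ l, v l * F.gen l = 0) (l : Fin (F.rank 0)) : constantCoeff (v l) = 0 := by
  obtain ⟨w, rfl⟩ := F.exists_mulVec_eq_of_sum_gen hv
  exact F.constantCoeff_mulVec_diff 0 w l

theorem constantCoeff_of_diff_mulVec {w : Fin (F.rank 1) → MvPolynomial (Fin n) k}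
    (hw : F.diff 0 *ᵥ w = 0) (j : Fin (F.rank 1)) : constantCoeff (w j) = 0 := by
  obtain ⟨z, rfl⟩ := (F.exact_succ 0 w).1 (by simpa using hw)
  exact F.constantCoeff_mulVec_diff 1 z j

theorem sum_diff_mul_gen (j : Fin (F.rank 1)) : ∑ l, F.diff 0 l j * F.gen l = 0 := by
  have := (F.exact_zero (F.diff 0 *ᵥ Pi.single j 1)).2 ⟨Pi.single j 1, by simp⟩
  simpa [Fintype.linearCombination_apply] using this

/-- A zero column would make a basis vector a cycle, hence a boundary, but boundaries have no
constant terms. -/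
theorem exists_diff_ne_zero (j : Fin (F.rank 1)) : ∃ l, F.diff 0 l j ≠ 0 := by
  by_contra! h
  have := F.constantCoeff_of_diff_mulVec (w := Pi.single j 1)
    (by ext1 l; simpa using h l) j
  simp at this

variable {d : ℕ} {f : Fin 3 → MvPolynomial (Fin n) k} (hf : ∀ i, (f i).IsHomogeneous d)
  (hJ : J = Ideal.span (Set.range f))

include hf hJ

/-- The generators in a minimal resolution of an ideal generated by three forms of degree `d`
are at most three, and they have degree `d`. -/
theorem rank_zero_le_and_shift_zero : F.rank 0 ≤ 3 ∧ ∀ j, F.shift 0 j = d := by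
  have hB : ∀ i, ∃ B : Fin (F.rank 0) → MvPolynomial (Fin n) k,
      ∑ l, degreePart ((d : ℤ) - F.shift 0 l) (B l) * F.gen l = f i := fun i => by
    have hmem : f i ∈ Ideal.span (Set.range F.gen) := by
      rw [F.span_gen, hJ]
      exact Ideal.subset_span ⟨i, rfl⟩
    obtain ⟨B, hB⟩ := Ideal.mem_span_range_iff_exists_fun.1 hmem
    refine ⟨B, ?_⟩
    conv_rhs => rw [← (hf i).isFormOfDegree.degreePart_eq, ← hB, degreePart_sum]
    exact Finset.sum_congr rfl fun l _ => ((F.gen_form l).degreePart_mul _ _).symm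
  have hA : ∀ j, ∃ A : Fin 3 → MvPolynomial (Fin n) k, ∑ i, A i * f i = F.gen j := fun j => by
    have hmem : F.gen j ∈ Ideal.span (Set.range f) := by
      exact (F.span_gen.trans hJ) ▸ Ideal.subset_span ⟨j, rfl⟩
    exact Ideal.mem_span_range_iff_exists_fun.1 hmem
  choose B hB using hB
  choose A hA using hA
  let B' : Matrix (Fin 3) (Fin (F.rank 0)) k := Matrix.of fun i l =>
    constantCoeff (degreePart ((d : ℤ) - F.shift 0 l) (B i l))
  let A' : Matrix (Fin (F.rank 0)) (Fin 3) k := Matrix.of fun j i => constantCoeff (A j i)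
  -- Rewriting `gen` through `f` and back differs from the identity by relations, which have no
  -- constant terms. So the identity factors through k³.
  have hAB : A' * B' = 1 := by
    ext j l
    have h := F.constantCoeff_of_sum_gen (v := fun l =>
      (∑ i, A j i * degreePart ((d : ℤ) - F.shift 0 l) (B i l)) - (Pi.single j 1 : _ → _) l) (by
        simp only [sub_mul, Finset.sum_sub_distrib, Finset.sum_mul]
        rw [Finset.sum_comm, sub_eq_zero]
        simp only [mul_assoc, ← Finset.mul_sum, hB, hA]
        simp [Pi.single_apply]) l
    simp only [map_sub, map_sum, map_mul, sub_eq_zero] at h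
    rw [Matrix.mul_apply]
    simp only [A', B', Matrix.of_apply]
    rw [h, Matrix.one_apply, Pi.single_apply]
    by_cases hjl : j = l
    · simp [hjl]
    · simp [hjl, Ne.symm hjl]
  constructor
  · have h1 := Matrix.rank_mul_le_left A' B'
    rw [hAB, Matrix.rank_one] at h1
    simpa using h1.trans (Matrix.rank_le_width A')
  · intro j
    by_contra hne
    have h1 := congrFun (congrFun hAB j) j
    rw [Matrix.mul_apply, Matrix.one_apply_eq] at h1
    refine zero_ne_one (Eq.trans (Eq.symm ?_) h1)
    refine Finset.sum_eq_zero fun i _ => ?_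
    -- A component of nonzero degree has no constant term.
    have : B' i j = 0 := by
      simp only [B', Matrix.of_apply, constantCoeff_eq, coeff_degreePart]
      rw [if_neg]
      simp only [map_zero, Nat.cast_zero]
      omega
    rw [this, mul_zero]

theorem le_shift_one (j : Fin (F.rank 1)) : (d : ℤ) ≤ F.shift 1 j := by
  obtain ⟨l, hl⟩ := F.exists_diff_ne_zero j
  have h := (F.diff_form 0 l j).nonneg hl
  rw [(F.rank_zero_le_and_shift_zero hf hJ).2 l] at h
  simpa using h

/-- A relation whose entries are forms of degree `e` is a combination of the minimal relations of
degree at most `d + e`. -/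
theorem exists_sum_diff_eq {e : ℤ} {v : Fin (F.rank 0) → MvPolynomial (Fin n) k}
    (hv : ∑ l, v l * F.gen l = 0) (hve : ∀ l, IsFormOfDegree (v l) e) :
    ∃ a : Fin (F.rank 1) → MvPolynomial (Fin n) k,
      ∀ l, ∑ j with F.shift 1 j ≤ d + e, a j * F.diff 0 l j = v l := by
  obtain ⟨w, rfl⟩ := F.exists_mulVec_eq_of_sum_gen hv
  -- Only the component of `w j` in this degree contributes; it vanishes when the degree is
  -- negative.
  refine ⟨fun j => degreePart (e - (F.shift 1 j - d)) (w j), fun l => ?_⟩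
  have hs := (F.rank_zero_le_and_shift_zero hf hJ).2 l
  rw [← (hve l).degreePart_eq, mulVec, dotProduct, degreePart_sum, Finset.sum_filter]
  refine Finset.sum_congr rfl fun j _ => ?_
  rw [mul_comm (F.diff 0 l j), (F.diff_form 0 l j).degreePart_mul, hs]
  split_ifs with h
  · rfl
  · have hneg : e - (F.shift (0 + 1) j - d) < 0 := by
      change e - (F.shift 1 j - d) < 0
      omega
    simp [degreePart_of_neg hneg]

/-- If the ideal has height two and is not perfect, there are three minimal generators. -/
theorem rank_zero_eq (hht : J.height = 2) (hperf : ¬ IsPerfectIdeal J) : F.rank 0 = 3 := by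
  refine le_antisymm (F.rank_zero_le_and_shift_zero hf hJ).1 ?_
  by_contra! h
  exact hperf (isPerfectIdeal_of_span_range hht (by omega) F.gen F.span_gen)

end MinimalGradedFreeResolution

/-! ### Relations of degree at most 2d -/

/-- The combinations of at most two vectors of a submodule are the combinations of two vectors of
the submodule. -/
theorem exists_two_of_card_le_two {R M ι : Type*} [CommRing R] [AddCommGroup M] [Module R M]
    (N : Submodule R M) (S : Finset ι) (hS : S.card ≤ 2) (c : ι → M) (hc : ∀ i, c i ∈ N) :
    ∃ s ∈ N, ∃ t ∈ N, ∀ a : ι → R, ∃ x y : R, ∑ i ∈ S, a i • c i = x • s + y • t := by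
  classical
  obtain h | h | h : S.card = 0 ∨ S.card = 1 ∨ S.card = 2 := by omega
  · rw [Finset.card_eq_zero] at h
    exact ⟨0, N.zero_mem, 0, N.zero_mem, fun a => ⟨0, 0, by simp [h]⟩⟩
  · obtain ⟨i, rfl⟩ := Finset.card_eq_one.1 h
    exact ⟨c i, hc i, 0, N.zero_mem, fun a => ⟨a i, 0, by simp⟩⟩
  · obtain ⟨i, j, hij, rfl⟩ := Finset.card_eq_two.1 h
    exact ⟨c i, hc i, c j, hc j, fun a => ⟨a i, a j, Finset.sum_pair hij⟩⟩

open Matrix in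
/-- If the ideal has height two and is not perfect, at least three minimal relations have degree at
most `2 * d`. -/
theorem MinimalGradedFreeResolution.two_lt_card_filter_shift_one
    {J : Ideal (MvPolynomial (Fin n) k)} (F : MinimalGradedFreeResolution J)
    {d : ℕ} {f : Fin 3 → MvPolynomial (Fin n) k} (hf : ∀ i, (f i).IsHomogeneous d)
    (hJ : J = Ideal.span (Set.range f)) (hht : J.height = 2) (hperf : ¬ IsPerfectIdeal J) :
    2 < (Finset.univ.filter fun j => F.shift 1 j ≤ (d : ℤ) + d).card := by
  by_contra! hcard
  let e : Fin 3 ≃ Fin (F.rank 0) := finCongr (F.rank_zero_eq hf hJ hht hperf).symm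
  let g : Fin 3 → MvPolynomial (Fin n) k := F.gen ∘ e
  have hg : Ideal.span (Set.range g) = J := by
    rw [← F.span_gen, e.surjective.range_comp]
  have hgform : ∀ i, IsFormOfDegree (g i) d := fun i => by
    rw [← (F.rank_zero_le_and_shift_zero hf hJ).2 (e i)]
    exact F.gen_form (e i)
  let N : Submodule (MvPolynomial (Fin n) k) (Fin 3 → MvPolynomial (Fin n) k) :=
    LinearMap.ker (Fintype.linearCombination (MvPolynomial (Fin n) k) g)
  have hN : ∀ v, v ∈ N ↔ v ⬝ᵥ g = 0 := fun v => by
    simp [N, Fintype.linearCombination_apply, dotProduct]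
  obtain ⟨s, hs, t, ht, hst⟩ := exists_two_of_card_le_two N _ hcard
    (fun j i => F.diff 0 (e i) j) fun j => by
      rw [hN, dotProduct, ← F.sum_diff_mul_gen j]
      exact Equiv.sum_comp e fun l => F.diff 0 l j * F.gen l
  refine hperf (isPerfectIdeal_of_koszul hht g s t hg ((hN s).1 hs) ((hN t).1 ht) fun i => ?_)
  -- The Koszul relation e_i × g has entries 0 and ± g_l, forms of degree d.
  obtain ⟨a, ha⟩ := F.exists_sum_diff_eq hf hJ (e := d)
    (v := (Pi.single i 1 ⨯₃ g) ∘ e.symm) (by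
      rw [← Equiv.sum_comp e]
      have h := dot_cross_self (Pi.single i 1) g
      rw [dotProduct_comm] at h
      simpa [dotProduct, g] using h) (fun l => by
      have hneg : ∀ i, IsFormOfDegree (-g i) d := fun i m hm => hgform i m (by simpa using hm)
      have hzero : IsFormOfDegree (0 : MvPolynomial (Fin n) k) d := fun m hm => by simp at hm
      simp only [Function.comp_apply]
      generalize e.symm l = l'
      fin_cases i <;> fin_cases l' <;> simp [cross_apply, hgform, hneg, hzero])
  obtain ⟨x, y, hxy⟩ := hst a
  refine ⟨x, y, ?_⟩
  rw [← hxy]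
  ext1 l
  have := ha (e l)
  simp only [Function.comp_apply, Equiv.symm_apply_apply] at this
  rw [← this]
  simp [Finset.sum_apply]

end Graded

theorem theorem2p2 {k : Type u} [Field k] (n : ℕ) (hn : 3 ≤ n) (d : ℕ)
    (J : Ideal (MvPolynomial (Fin n) k))
    (hgen : ∃ f : Fin 3 → MvPolynomial (Fin n) k,
      (∀ i, (f i).IsHomogeneous d) ∧ J = Ideal.span (Set.range f))
    (hht : J.height = 2) (hperf : ¬ IsPerfectIdeal J)
    (F : MinimalGradedFreeResolution J) :
    F.rank 0 = 3 ∧ (∀ j, F.shift 0 j = d) ∧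
      ∃ (m : ℕ) (hm : 3 ≤ m) (δ : Fin m → ℕ) (σ : Fin m ≃ Fin (F.rank 1)),
        Monotone δ ∧ (∀ i, F.shift 1 (σ i) = (d : ℤ) + (δ i : ℤ)) ∧ δ ⟨2, hm⟩ ≤ d := by
  obtain ⟨f, hf, hJ⟩ := hgen
  have hcard := F.two_lt_card_filter_shift_one hf hJ hht hperf
  let δ : Fin (F.rank 1) → ℕ := fun j => (F.shift 1 j - d).toNat
  have hδ : ∀ j, F.shift 1 j = (d : ℤ) + (δ j : ℤ) := fun j => by
    have := F.le_shift_one hf hJ j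
    simp only [δ]
    omega
  have hm : 3 ≤ F.rank 1 := by
    have := hcard.trans_le (Finset.card_filter_le _ _)
    rwa [Finset.card_univ, Fintype.card_fin] at this
  have hmono : Monotone (δ ∘ Tuple.sort δ) := Tuple.monotone_sort δ
  refine ⟨F.rank_zero_eq hf hJ hht hperf, (F.rank_zero_le_and_shift_zero hf hJ).2, F.rank 1, hm,
    δ ∘ Tuple.sort δ, Tuple.sort δ, hmono, fun i => hδ _, ?_⟩
  by_contra! hlt
  -- If the third smallest δ exceeds d, relations of degree ≤ 2d occupy only sorted positions 0 and
  -- 1.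
  have hsub : (Finset.univ.filter fun j => F.shift 1 j ≤ (d : ℤ) + d) ⊆
      (Finset.univ.filter fun i : Fin (F.rank 1) => (i : ℕ) < 2).map
        (Tuple.sort δ).toEmbedding := by
    intro j hj
    rw [Finset.mem_filter, hδ j] at hj
    refine Finset.mem_map.2 ⟨(Tuple.sort δ).symm j, ?_, by simp⟩
    rw [Finset.mem_filter]
    refine ⟨Finset.mem_univ _, ?_⟩
    by_contra! hle
    have := hmono (show (⟨2, hm⟩ : Fin (F.rank 1)) ≤ (Tuple.sort δ).symm j from hle)
    simp only [Function.comp_apply, Equiv.apply_symm_apply] at this hlt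
    omega
  have h2 := Finset.card_le_card hsub
  rw [Finset.card_map] at h2
  have h3 : (Finset.univ.filter fun i : Fin (F.rank 1) => (i : ℕ) < 2).card ≤ 2 := by
    rw [← Finset.card_range 2]
    refine Finset.card_le_card_of_injOn (fun i => (i : ℕ)) ?_ fun i _ j _ hij => Fin.ext hij
    intro i hi
    simpa using hi
  omega
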